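/- Let $n\ge 0$ and $g_1,\dots,g_n\in\mathbb R[x_1,\dots,x_n]$. For $p\in\mathbb R[x_1,\dots,x_n]$ let $\bar p(x_0,\dots,x_n)=x_0^{\deg p}\,p(x_1/x_0,\dots,x_n/x_0)$ be its homogenization, and let $p^\infty(x_1,\dots,x_n)=\bar p(0,x_1,\dots,x_n)$ (for $p=0$, put $\bar p=0$, $p^\infty=0$ and $\deg p=0$). Assume that the equations $g_1^\infty(z)=\cdots=g_n^\infty(z)=0$ have no solution $z\in\mathbb C^n\setminus\{0\}$. Let $\mathbf S=\mathbb R[x_0,\dots,x_n]$, let $\mathbf I=\langle\bar g_1,\dots,\bar g_n\rangle\subseteq\mathbf S$, let $\mathbf S_d$ be the real vector space of homogeneous polynomials of degree $d$ in $\mathbf S$ (including $0$), and let $\mathbf I_d=\mathbf I\cap\mathbf S_d$. Then: 1. If every $g_i$ has positive degree, then $\bar g_1,\dots,\bar g_n$ is a regular sequence on $\mathbf S$, i.e. $\mathbf I\neq\mathbf S$ and, for each $i=1,\dots,n$, $\bar g_i$ is not a zero-divisor on $\mathbf S/\langle\bar g_1,\dots,\bar g_{i-1}\rangle$. 2. For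 every integer $d\ge 0$, $$\dim_{\mathbb R}\mathbf S_d/\mathbf I_d=\sum_{k=0}^{d}\mathfrak c_k,$$ where $$\mathfrak c_k=\bigl|\{(k_1,\dots,k_n)\in\mathbb N^n:\ k_1+\cdots+k_n=k,\ 0\le k_i\le \deg g_i-1\ \text{for all } i\}\bigr|.$$ -/

import Mathlib

open MvPolynomial

/-- The homogenization `p̄(x₀, …, xₙ) = x₀ ^ deg p * p (x₁ / x₀, …, xₙ / x₀)` of a polynomial
`p ∈ ℝ[x₁, …, xₙ]`: the homogeneous component of degree `e` of `p` is multiplied by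
`x₀ ^ (deg p - e)`. The variable `x₀` has index `0 : Fin (n + 1)`, the variable of `p` with
index `i : Fin n` becomes the one with index `i.succ`. -/
noncomputable def homogenization {n : ℕ} (p : MvPolynomial (Fin n) ℝ) :
    MvPolynomial (Fin (n + 1)) ℝ :=
  ∑ e ∈ Finset.range (p.totalDegree + 1),
    X 0 ^ (p.totalDegree - e) * rename Fin.succ (homogeneousComponent e p)

/-- The polynomial `p^∞(x₁, …, xₙ) = p̄(0, x₁, …, xₙ)`. -/
noncomputable def atInfinity {n : ℕ} (p : MvPolynomial (Fin n) ℝ) : MvPolynomial (Fin n) ℝ :=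
  aeval (Fin.cons 0 X : Fin (n + 1) → MvPolynomial (Fin n) ℝ) (homogenization p)

/-- The equations `g₁^∞(z) = ⋯ = gₙ^∞(z) = 0` have no solution `z ∈ ℂⁿ ∖ {0}`. -/
def NoSolutionAtInfinity {n : ℕ} (g : Fin n → MvPolynomial (Fin n) ℝ) : Prop :=
  ¬ ∃ z : Fin n → ℂ, z ≠ 0 ∧ ∀ i, aeval z (atInfinity (g i)) = 0

/-- The ideal `𝐈 = ⟨ḡ₁, …, ḡₙ⟩` of `𝐒 = ℝ[x₀, …, xₙ]`. -/
noncomputable def homogenizedIdeal {n : ℕ} (g : Fin n → MvPolynomial (Fin n) ℝ) :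
    Ideal (MvPolynomial (Fin (n + 1)) ℝ) :=
  Ideal.span (Set.range fun i => homogenization (g i))

/-- For an ideal `I` of `ℝ[x₀, …, xₙ]`, the part `I_d = I ∩ 𝐒_d` of degree `d`, as an
`ℝ`-subspace of the space `𝐒_d` of homogeneous polynomials of degree `d`. -/
noncomputable def gradedPart {n : ℕ} (I : Ideal (MvPolynomial (Fin (n + 1)) ℝ)) (d : ℕ) :
    Submodule ℝ (homogeneousSubmodule (Fin (n + 1)) ℝ d) :=
  (I.restrictScalars ℝ).submoduleOf (homogeneousSubmodule (Fin (n + 1)) ℝ d)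

/-- The number `𝔠ₖ` of tuples `(k₁, …, kₙ) ∈ ℕⁿ` with `k₁ + ⋯ + kₙ = k` and
`0 ≤ kᵢ ≤ deg gᵢ - 1`, that is `kᵢ < deg gᵢ`, for all `i`. -/
def boundedTupleCount {n : ℕ} (g : Fin n → MvPolynomial (Fin n) ℝ) (k : ℕ) : ℕ :=
  ((Fintype.piFinset fun i => Finset.range (g i).totalDegree).filter
    fun κ : Fin n → ℕ => ∑ i, κ i = k).card

/-! Setting `x₀ = 0` in the `ḡᵢ` gives the `gᵢ^∞`, so the forms `ḡ₁, …, ḡₙ, x₀` have only the origin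
as a common zero in `ℂⁿ⁺¹`. By the Nullstellensatz every variable lies in the radical of their ideal
(`X_mem_radical_initialIdeal`). As many forms of positive degree as variables, with this property,
form a regular sequence (`isWeaklyRegularUpTo_of_radical`); this yields part 1.

That criterion is proved by induction on the number of variables. Prime avoidance and Krull's
principal ideal theorem allow the last form to be replaced by a linear form `l`
(`exists_linear_radical`). Modulo `l` one variable disappears and the induction hypothesis applies;
homogeneity lets `l` move to the end of the sequence (`isWeaklyRegularUpTo_of_sup`). Finally `l` is
exchanged for the last form, since a power of `l` lies in the ideal of all the forms.

For part 2, a regular form of degree `e` multiplies the Hilbert series by `1 - X ^ e`. The series of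
`𝐒/𝐈` is thus `∏ (1 - X ^ deg gᵢ) / (1 - X) ^ (n + 1)`, that is, `1 / (1 - X)` times a product of
geometric sums whose coefficients are the `𝔠ₖ`; the factor `1 / (1 - X)` produces partial sums. If
some `gᵢ` is a nonzero constant, both sides vanish. -/

section Swap

/-! ### Permuting homogeneous regular sequences. -/

variable {A S : Type*} [CommRing A] [SetLike S A] [AddSubmonoidClass S A]

/-- If `l` is regular modulo a homogeneous ideal `J` and a homogeneous `f` is regular modulo
`J + (l)`, then `f` is regular modulo `J`, provided that `l` is homogeneous of positive degree. -/
theorem Ideal.IsHomogeneous.mem_of_mul_mem_of_sup {𝒜 : ℕ → S} [GradedRing 𝒜] {J : Ideal A}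
    (hJ : J.IsHomogeneous 𝒜) {l f : A} {c d : ℕ} (hc : 0 < c) (hlc : l ∈ 𝒜 c) (hfd : f ∈ 𝒜 d)
    (hl : ∀ u, l * u ∈ J → u ∈ J)
    (hf : ∀ u, f * u ∈ J ⊔ Ideal.span {l} → u ∈ J ⊔ Ideal.span {l}) (u : A) (hu : f * u ∈ J) :
    u ∈ J := by
  rw [hJ.mem_iff]
  intro e
  induction e using Nat.strong_induction_on generalizing u with
  | _ e ih =>
    set v : A := ((DirectSum.decompose 𝒜 u e : 𝒜 e) : A)
    have hve : v ∈ 𝒜 e := SetLike.coe_mem _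
    have hfv : f * v ∈ J := by
      have := hJ (d + e) hu
      rwa [DirectSum.coe_decompose_mul_of_left_mem_of_le 𝒜 hfd (Nat.le_add_right d e),
        Nat.add_sub_cancel_left] at this
    -- Write `v = j + w * l` and compare components of degree `e`. Cancelling `l` puts `f * w'` in
    -- `J`, where `w'` has degree `e - c < e`, so the induction applies; for `e < c` the `l`-part
    -- vanishes.
    obtain ⟨j, hj, y, hy, hjy⟩ := Submodule.mem_sup.1 (hf v (Ideal.mem_sup_left hfv))
    obtain ⟨w, rfl⟩ := Ideal.mem_span_singleton'.1 hy
    have hcomp : v = DirectSum.decompose 𝒜 j e + DirectSum.decompose 𝒜 (l * w) e := by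
      conv_lhs => rw [← DirectSum.decompose_of_mem_same 𝒜 hve, ← hjy, mul_comm w l]
      rw [DirectSum.decompose_add, DirectSum.add_apply, AddMemClass.coe_add]
    have hje := hJ e hj
    by_cases hce : c ≤ e
    · rw [DirectSum.coe_decompose_mul_of_left_mem_of_le 𝒜 hlc hce] at hcomp
      set w' : A := ((DirectSum.decompose 𝒜 w (e - c) : 𝒜 (e - c)) : A)
      have hw' : f * w' ∈ J := by
        refine hl _ ?_
        have : l * (f * w') = f * v - f * DirectSum.decompose 𝒜 j e := by rw [hcomp]; ring
        rw [this]
        exact J.sub_mem hfv (J.mul_mem_left _ hje)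
      have := ih (e - c) (by omega) w' hw'
      rw [DirectSum.decompose_of_mem_same 𝒜 (SetLike.coe_mem _)] at this
      rw [hcomp]
      exact J.add_mem hje (J.mul_mem_left _ this)
    · rw [DirectSum.coe_decompose_mul_of_left_mem_of_not_le 𝒜 hlc hce, add_zero] at hcomp
      rwa [hcomp]

/-- From `l * u = j + v * f`, regularity of `f` modulo `J + (l)` gives `v = j' + w * l`. Then `l *
(u - f * w)` is in `J`, and `l` cancels. No grading is needed. -/
theorem Ideal.mem_sup_of_mul_mem_sup {J : Ideal A} {l f : A}
    (hl : ∀ u, l * u ∈ J → u ∈ J)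
    (hf : ∀ u, f * u ∈ J ⊔ Ideal.span {l} → u ∈ J ⊔ Ideal.span {l}) (u : A)
    (hu : l * u ∈ J ⊔ Ideal.span {f}) : u ∈ J ⊔ Ideal.span {f} := by
  obtain ⟨j, hj, y, hy, hjy⟩ := Submodule.mem_sup.1 hu
  obtain ⟨v, rfl⟩ := Ideal.mem_span_singleton'.1 hy
  have hv : f * v ∈ J ⊔ Ideal.span {l} := by
    have : f * v = - j + u * l := by linear_combination hjy
    rw [this]
    exact Submodule.add_mem_sup (J.neg_mem hj) (Ideal.mem_span_singleton'.2 ⟨u, rfl⟩)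
  obtain ⟨j', hj', y, hy, hjy'⟩ := Submodule.mem_sup.1 (hf v hv)
  obtain ⟨w, rfl⟩ := Ideal.mem_span_singleton'.1 hy
  have h1 : u - f * w ∈ J := by
    refine hl _ ?_
    have : l * (u - f * w) = j + f * j' := by linear_combination -hjy - f * hjy'
    rw [this]
    exact J.add_mem hj (J.mul_mem_left _ hj')
  have : u = (u - f * w) + w * f := by ring
  rw [this]
  exact Submodule.add_mem_sup h1 (Ideal.mem_span_singleton'.2 ⟨w, rfl⟩)

/-- The ideal generated by the members of index `< i` of a sequence. -/
def initialIdeal (f : ℕ → A) (i : ℕ) : Ideal A := Ideal.span (f '' Set.Iio i)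

theorem initialIdeal_zero (f : ℕ → A) : initialIdeal f 0 = ⊥ := by
  simp [initialIdeal]

theorem initialIdeal_succ (f : ℕ → A) (i : ℕ) :
    initialIdeal f (i + 1) = initialIdeal f i ⊔ Ideal.span {f i} := by
  have : Set.Iio (i + 1) = insert i (Set.Iio i) := by ext j; simp
  rw [initialIdeal, initialIdeal, ← Ideal.span_union, this, Set.image_insert_eq, Set.insert_eq,
    Set.union_comm]

theorem initialIdeal_mono (f : ℕ → A) : Monotone (initialIdeal f) := fun _ _ h =>
  Ideal.span_mono (Set.image_mono (Set.Iio_subset_Iio h))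

theorem map_initialIdeal {B : Type*} [CommRing B] (φ : A →+* B) (f : ℕ → A) (i : ℕ) :
    (initialIdeal f i).map φ = initialIdeal (φ ∘ f) i := by
  rw [initialIdeal, initialIdeal, Ideal.map_span, Set.image_comp]

/-- The first `n` members of the sequence `f` form a weakly regular sequence on the ring. -/
def IsWeaklyRegularUpTo (f : ℕ → A) (n : ℕ) : Prop :=
  ∀ i < n, ∀ u, f i * u ∈ initialIdeal f i → u ∈ initialIdeal f i

theorem isHomogeneous_initialIdeal {𝒜 : ℕ → S} [GradedRing 𝒜] {f : ℕ → A} {e : ℕ → ℕ} {i : ℕ}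
    (hf : ∀ j < i, f j ∈ 𝒜 (e j)) : (initialIdeal f i).IsHomogeneous 𝒜 :=
  Ideal.homogeneous_span _ _ (by rintro _ ⟨j, hj, rfl⟩; exact ⟨e j, hf j hj⟩)

/-- A homogeneous nonzerodivisor `l` of positive degree can be moved from the beginning of a
homogeneous regular sequence to its end. -/
theorem isWeaklyRegularUpTo_of_sup {𝒜 : ℕ → S} [GradedRing 𝒜] {f : ℕ → A} {e : ℕ → ℕ}
    {l : A} {c n : ℕ} (hc : 0 < c) (hlc : l ∈ 𝒜 c) (hl : ∀ u, l * u = 0 → u = 0)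
    (hfe : ∀ j < n, f j ∈ 𝒜 (e j))
    (h : ∀ i < n, ∀ u, f i * u ∈ initialIdeal f i ⊔ Ideal.span {l} →
      u ∈ initialIdeal f i ⊔ Ideal.span {l}) :
    IsWeaklyRegularUpTo f n ∧ ∀ u, l * u ∈ initialIdeal f n → u ∈ initialIdeal f n := by
  have key : ∀ i ≤ n, ∀ u, l * u ∈ initialIdeal f i → u ∈ initialIdeal f i := by
    intro i
    induction i with
    | zero => simpa [initialIdeal_zero] using hl
    | succ i ih =>
      intro hi
      rw [initialIdeal_succ]
      exact Ideal.mem_sup_of_mul_mem_sup (ih (by omega)) (h i (by omega))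
  refine ⟨fun i hi => ?_, key n le_rfl⟩
  exact (isHomogeneous_initialIdeal fun j hj => hfe j (by omega)).mem_of_mul_mem_of_sup hc hlc
    (hfe i hi) (key i hi.le) (h i hi)

end Swap

/-! ### Generic linear forms and elimination of a variable. -/

section LinearForm

attribute [local instance] MvPolynomial.gradedAlgebra

variable {σ k : Type*} [Field k]

theorem MvPolynomial.mem_idealOfVars_iff_constantCoeff {p : MvPolynomial σ k} :
    p ∈ idealOfVars σ k ↔ constantCoeff p = 0 := by
  rw [← pow_one (idealOfVars σ k), mem_pow_idealOfVars_iff']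
  simp only [Nat.lt_one_iff, Finsupp.degree_eq_zero_iff, forall_eq, constantCoeff_eq]

instance MvPolynomial.isPrime_idealOfVars : (idealOfVars σ k).IsPrime := by
  have : idealOfVars σ k = RingHom.ker (constantCoeff (σ := σ) (R := k)) := by
    ext p
    rw [mem_idealOfVars_iff_constantCoeff, RingHom.mem_ker]
  rw [this]
  exact RingHom.ker_isPrime _

theorem MvPolynomial.IsHomogeneous.mem_idealOfVars {p : MvPolynomial σ k} {d : ℕ}
    (hp : p.IsHomogeneous d) (hd : 0 < d) : p ∈ idealOfVars σ k := by
  rw [mem_idealOfVars_iff_constantCoeff, constantCoeff_eq]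
  exact hp.coeff_eq_zero (by simpa using hd.ne)

theorem Ideal.IsHomogeneous.le_idealOfVars {Q : Ideal (MvPolynomial σ k)}
    (hQ : Q.IsHomogeneous (homogeneousSubmodule σ k)) (h : Q ≠ ⊤) : Q ≤ idealOfVars σ k := by
  intro p hp
  rw [mem_idealOfVars_iff_constantCoeff, constantCoeff_eq]
  by_contra hc
  have := homogeneousComponent_mem_of_mem hQ hp 0
  rw [homogeneousComponent_zero] at this
  exact h (Q.eq_top_of_isUnit_mem this ((isUnit_iff_ne_zero.2 hc).map C))

/-- If `P ⊊ Q ≤ M` are primes and `M` is minimal over `P + (x)`, then `Q = M`. -/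
theorem Ideal.eq_of_lt_of_mem_minimalPrimes_sup {R : Type*} [CommRing R] [IsNoetherianRing R]
    {P Q M : Ideal R} [P.IsPrime] [Q.IsPrime] {x : R} (hPQ : P < Q) (hQM : Q ≤ M)
    (hM : M ∈ (P ⊔ Ideal.span {x}).minimalPrimes) : Q = M := by
  by_contra hne
  have hMp : M.IsPrime := hM.isPrime
  have hPM := hPQ.le.trans hQM
  have hker : RingHom.ker (Ideal.Quotient.mk P) = P := Ideal.mk_ker
  have hQ' : (Q.map (Ideal.Quotient.mk P)).IsPrime :=
    Ideal.map_isPrime_of_surjective Ideal.Quotient.mk_surjective (hker.trans_le hPQ.le)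
  have hM' : (M.map (Ideal.Quotient.mk P)).IsPrime :=
    Ideal.map_isPrime_of_surjective Ideal.Quotient.mk_surjective (hker.trans_le hPM)
  have hcomap : ∀ I : Ideal R, P ≤ I → (I.map (Ideal.Quotient.mk P)).comap
      (Ideal.Quotient.mk P) = I := fun I hI => by
    rw [Ideal.comap_map_of_surjective' _ Ideal.Quotient.mk_surjective, hker, sup_eq_left.2 hI]
  have hlt : Q.map (Ideal.Quotient.mk P) < M.map (Ideal.Quotient.mk P) := by
    refine lt_of_le_of_ne (Ideal.map_mono hQM) fun h => hne ?_
    rw [← hcomap Q hPQ.le, h, hcomap M hPM]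
  have h0 : (Q.map (Ideal.Quotient.mk P)).height = 0 :=
    Order.lt_one_iff.1 ((Ideal.height_strict_mono_of_isPrime hlt).trans_le
      (Ideal.map_height_le_one_of_mem_minimalPrimes hM))
  rw [Ideal.height_eq_zero_iff_eq_bot] at h0
  have := hcomap Q hPQ.le
  rw [h0, ← RingHom.ker_eq_comap_bot, hker] at this
  exact hPQ.ne this

/-- Let `J` be a homogeneous ideal such that `J + (f)` is primary to the ideal of the variables.
Then `J + (l)` is so for some nonzero linear form `l`. -/
theorem MvPolynomial.exists_linear_radical [Fintype σ] [Nonempty σ] [Infinite k]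
    {J : Ideal (MvPolynomial σ k)} (hJ : J.IsHomogeneous (homogeneousSubmodule σ k))
    {f : MvPolynomial σ k} (hJf : J ⊔ Ideal.span {f} ≤ idealOfVars σ k)
    (hf : ∀ i, X i ∈ (J ⊔ Ideal.span {f}).radical) :
    ∃ c : σ → k, c ≠ 0 ∧ ∀ i, X i ∈ (J ⊔ Ideal.span {∑ i, c i • X i}).radical := by
  classical
  set L : (σ → k) →ₗ[k] MvPolynomial σ k := Fintype.linearCombination k X with hL
  let V : Ideal (MvPolynomial σ k) → Subspace k (σ → k) := fun P =>
    (P.restrictScalars k).comap L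
  have hfin : {P ∈ J.minimalPrimes | ¬ idealOfVars σ k ≤ P}.Finite :=
    (Ideal.finite_minimalPrimes_of_isNoetherianRing _ J).subset (Set.sep_subset _ _)
  -- Over an infinite field, finitely many proper subspaces do not cover the space. Including `⊥`
  -- forces `c ≠ 0`.
  have htop : ⊤ ∉ insert ⊥ (hfin.toFinset.image V) := by
    rw [Finset.mem_insert, Finset.mem_image, not_or]
    refine ⟨top_ne_bot, ?_⟩
    rintro ⟨P, hP, hPV⟩
    rw [Set.Finite.mem_toFinset] at hP
    refine hP.2 (Ideal.span_le.2 ?_)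
    rintro _ ⟨i, rfl⟩
    have : Pi.single i 1 ∈ V P := hPV ▸ Submodule.mem_top
    simpa [V, hL, Fintype.linearCombination_apply_single] using this
  obtain ⟨c, hc⟩ := (Set.ne_univ_iff_exists_notMem _).1
    (Subspace.biUnion_ne_univ_of_top_notMem htop)
  simp only [Finset.mem_insert, Finset.mem_image, Set.Finite.mem_toFinset, Set.mem_ofPred_eq,
    Set.mem_iUnion, SetLike.mem_coe, exists_prop, not_exists, not_and] at hc
  refine ⟨c, fun h0 => hc ⊥ (Or.inl rfl) (by simp [h0]), fun i => ?_⟩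
  have hLc : L c = ∑ i, c i • X i := by rw [hL, Fintype.linearCombination_apply]
  rw [← hLc]
  have hlin : (L c).IsHomogeneous 1 := by
    rw [hLc]
    exact IsHomogeneous.sum _ _ _ fun i _ => by
      rw [smul_eq_C_mul]; exact isHomogeneous_C_mul_X _ _
  have hom : (J ⊔ Ideal.span {L c}).IsHomogeneous (homogeneousSubmodule σ k) :=
    hJ.sup (Ideal.homogeneous_span _ _ (by rintro _ rfl; exact ⟨1, hlin⟩))
  -- Only homogeneous primes matter for the radical of a homogeneous ideal, and these lie inside the
  -- ideal of the variables.
  rw [hom.radical_eq, Ideal.mem_sInf]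
  rintro Q ⟨hQh, hJQ, hQ⟩
  obtain ⟨P, hP, hPQ⟩ := Ideal.exists_minimalPrimes_le (le_sup_left.trans hJQ)
  have hPp : P.IsPrime := hP.isPrime
  by_cases hmP : idealOfVars σ k ≤ P
  · exact hPQ (hmP (Ideal.subset_span ⟨i, rfl⟩))
  have hlP : L c ∉ P := fun h => hc (V P) (Or.inr ⟨P, ⟨hP, hmP⟩, rfl⟩) h
  have hlQ : L c ∈ Q := hJQ (Ideal.mem_sup_right (Ideal.mem_span_singleton_self _))
  have hlt : P < Q := lt_of_le_of_ne hPQ fun h => hlP (h ▸ hlQ)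
  have hQm : Q ≤ idealOfVars σ k := hQh.le_idealOfVars hQ.ne_top
  -- A prime over `P + (f)` contains `J + (f)`, hence every variable. By Krull's theorem no prime
  -- fits strictly between `P` and the ideal of the variables.
  have hM : idealOfVars σ k ∈ (P ⊔ Ideal.span {f}).minimalPrimes := by
    refine ⟨⟨isPrime_idealOfVars, sup_le (hPQ.trans hQm) (le_sup_right.trans hJf)⟩, ?_⟩
    rintro M ⟨hMp, hM⟩ -
    refine Ideal.span_le.2 ?_
    rintro _ ⟨j, rfl⟩
    exact (hMp.isRadical.radical_le_iff.2 ((sup_le_sup_right hP.1.2 _).trans hM)) (hf j)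
  rw [Ideal.eq_of_lt_of_mem_minimalPrimes_sup hlt hQm hM]
  exact Ideal.subset_span ⟨i, rfl⟩

/-- The substitution that solves the equation `∑ i, c i * X i = 0` for the variable `X j`. -/
noncomputable def solveLinear {n : ℕ} (c : Fin (n + 1) → k) (j : Fin (n + 1)) :
    MvPolynomial (Fin (n + 1)) k →ₐ[k] MvPolynomial (Fin n) k :=
  aeval (j.insertNth (-∑ i, ((c j)⁻¹ * c (j.succAbove i)) • X i) X :
    Fin (n + 1) → MvPolynomial (Fin n) k)

theorem solveLinear_rename {n : ℕ} (c : Fin (n + 1) → k) (j : Fin (n + 1))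
    (p : MvPolynomial (Fin n) k) : solveLinear c j (rename j.succAbove p) = p := by
  rw [solveLinear, aeval_rename]
  convert aeval_X_left_apply p
  ext i
  simp

theorem solveLinear_isHomogeneous {n : ℕ} (c : Fin (n + 1) → k) (j : Fin (n + 1))
    {p : MvPolynomial (Fin (n + 1)) k} {d : ℕ} (hp : p.IsHomogeneous d) :
    (solveLinear c j p).IsHomogeneous d := by
  have := hp.aeval (j.insertNth (-∑ i, ((c j)⁻¹ * c (j.succAbove i)) • X i) X :
    Fin (n + 1) → MvPolynomial (Fin n) k) (n := 1) ?_
  · rwa [one_mul] at this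
  intro i
  refine j.succAboveCases ?_ (fun i => ?_) i
  · rw [Fin.insertNth_apply_same]
    exact (IsHomogeneous.sum _ _ _ fun i _ => by
      rw [smul_eq_C_mul]; exact isHomogeneous_C_mul_X _ _).neg
  · rw [Fin.insertNth_apply_succAbove]
    exact isHomogeneous_X _ _

/-- Modulo the linear form, substituting for `X j` and renaming back is the identity, so whatever
the substitution kills is zero in the quotient. -/
theorem ker_solveLinear {n : ℕ} {c : Fin (n + 1) → k} {j : Fin (n + 1)} (hj : c j ≠ 0) :
    RingHom.ker (solveLinear c j).toRingHom = Ideal.span {∑ i, c i • X i} := by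
  apply le_antisymm
  · intro p hp
    set I : Ideal (MvPolynomial (Fin (n + 1)) k) := Ideal.span {∑ i, c i • X i} with hI
    have key : ((Ideal.Quotient.mkₐ k I).comp (rename j.succAbove)).comp (solveLinear c j) =
        Ideal.Quotient.mkₐ k I := by
      ext i
      refine j.succAboveCases ?_ (fun i => ?_) i
      · simp only [AlgHom.comp_apply, Ideal.Quotient.mkₐ_eq_mk]
        rw [Ideal.Quotient.eq, hI, Ideal.mem_span_singleton']
        refine ⟨-C (c j)⁻¹, ?_⟩
        rw [Fin.sum_univ_succAbove _ j]
        simp only [solveLinear, aeval_X, Fin.insertNth_apply_same, map_neg, map_sum,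
          smul_eq_C_mul, mul_add, Finset.mul_sum]
        rw [← mul_assoc, neg_mul, ← C_mul, inv_mul_cancel₀ hj, map_one, neg_one_mul,
          ← Finset.sum_neg_distrib, sub_eq_add_neg, add_comm _ (-X j)]
        congr 1
        refine Finset.sum_congr rfl fun i _ => ?_
        rw [map_mul, rename_C, rename_X, C_mul]; ring
      · simp [solveLinear]
    have := congrArg (fun φ => φ p) key
    simp only [AlgHom.comp_apply, Ideal.Quotient.mkₐ_eq_mk] at this
    rw [show solveLinear c j p = 0 from hp, map_zero, map_zero, eq_comm,
      Ideal.Quotient.eq_zero_iff_mem] at this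
    exact this
  · rw [Ideal.span_singleton_le_iff_mem, RingHom.mem_ker]
    change solveLinear c j _ = 0
    rw [Fin.sum_univ_succAbove _ j]
    simp only [solveLinear, aeval_X, Fin.insertNth_apply_same, map_add, map_sum, map_smul,
      Fin.insertNth_apply_succAbove, smul_neg, Finset.smul_sum, smul_smul]
    simp [mul_inv_cancel_left₀ hj]

end LinearForm

/-! ### The regularity criterion. -/

section Regular

attribute [local instance] MvPolynomial.gradedAlgebra

variable {k : Type*} [Field k] [Infinite k]

/-- In a polynomial ring in `n` variables over an infinite field, `n` forms of positive degree
that generate an ideal primary to the ideal of the variables form a regular sequence. -/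
theorem isWeaklyRegularUpTo_of_radical (n : ℕ) (f : ℕ → MvPolynomial (Fin n) k) (e : ℕ → ℕ)
    (he : ∀ i < n, 0 < e i) (hf : ∀ i < n, (f i).IsHomogeneous (e i))
    (hrad : ∀ i, X i ∈ (initialIdeal f n).radical) : IsWeaklyRegularUpTo f n := by
  induction n with
  | zero => intro i hi; omega
  | succ n ih =>
    set J := initialIdeal f n with hJ
    have hJhom : J.IsHomogeneous (homogeneousSubmodule (Fin (n + 1)) k) :=
      isHomogeneous_initialIdeal (e := e) fun j hj => hf j (by omega)
    rw [initialIdeal_succ, ← hJ] at hrad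
    have hle : J ⊔ Ideal.span {f n} ≤ idealOfVars (Fin (n + 1)) k := by
      rw [hJ, ← initialIdeal_succ, initialIdeal, Ideal.span_le]
      rintro _ ⟨j, hj, rfl⟩
      exact (hf j hj).mem_idealOfVars (he j hj)
    obtain ⟨c, hc, hl⟩ := exists_linear_radical hJhom hle hrad
    obtain ⟨j, hj⟩ := Function.ne_iff.1 hc
    set l : MvPolynomial (Fin (n + 1)) k := ∑ i, c i • X i with hldef
    have hlhom : l.IsHomogeneous 1 := IsHomogeneous.sum _ _ _ fun i _ => by
      rw [smul_eq_C_mul]; exact isHomogeneous_C_mul_X _ _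
    have hl0 : l ≠ 0 := by
      intro h0
      apply hj
      have := congrArg (coeff (Finsupp.single j 1)) h0
      simpa [hldef, coeff_sum, coeff_X, Finsupp.single_left_inj] using this
    set φ := (solveLinear c j).toRingHom with hφ
    have hker : RingHom.ker φ = Ideal.span {l} := ker_solveLinear hj
    have hsurj : Function.Surjective φ := fun p => ⟨_, solveLinear_rename c j p⟩
    have hcomap : ∀ i, (initialIdeal (φ ∘ f) i).comap φ = initialIdeal f i ⊔ Ideal.span {l} := by
      intro i
      rw [← map_initialIdeal, Ideal.comap_map_of_surjective' φ hsurj, hker]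
    have hreg := ih (φ ∘ f) (fun i hi => he i (by omega))
      (fun i hi => solveLinear_isHomogeneous c j (hf i (by omega))) (fun i => by
        obtain ⟨N, hN⟩ := hl (j.succAbove i)
        rw [hJ, ← hcomap, Ideal.mem_comap, map_pow] at hN
        refine ⟨N, ?_⟩
        have hX : φ (X (j.succAbove i)) = X i := by
          have := solveLinear_rename c j (X i)
          rwa [rename_X] at this
        rwa [hX] at hN)
    have h := isWeaklyRegularUpTo_of_sup (𝒜 := homogeneousSubmodule (Fin (n + 1)) k) (n := n)
      (f := f) (e := e) one_pos hlhom
      (fun u hu => (mul_eq_zero.1 hu).resolve_left hl0) (fun i hi => hf i (by omega))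
      (fun i hi u hu => by
        rw [← hcomap, Ideal.mem_comap, map_mul] at hu
        rw [← hcomap]
        exact hreg i hi _ hu)
    intro i hi u hu
    rcases Nat.lt_succ_iff_lt_or_eq.1 hi with hi | rfl
    · exact h.1 i hi u hu
    -- The last form: `l ^ N = a + b * f i` with `a ∈ J`, so `f i * u ∈ J` forces `l ^ N * u ∈ J`,
    -- and `l` is cancelled `N` times modulo `J`.
    have hlm : l ∈ (J ⊔ Ideal.span {f i}).radical :=
      Ideal.sum_mem _ fun m _ => Submodule.smul_of_tower_mem _ _ (hrad m)
    obtain ⟨N, hN⟩ := hlm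
    obtain ⟨a, ha, y, hy, hay⟩ := Submodule.mem_sup.1 hN
    obtain ⟨b, rfl⟩ := Ideal.mem_span_singleton'.1 hy
    have hNu : l ^ N * u ∈ J := by
      have : l ^ N * u = u * a + b * (f i * u) := by rw [← hay]; ring
      rw [this]
      exact J.add_mem (J.mul_mem_left _ ha) (J.mul_mem_left _ hu)
    clear hN hay
    induction N with
    | zero => simpa using hNu
    | succ N ihN => exact ihN (h.2 _ (by rwa [← mul_assoc, ← pow_succ']))

end Regular

/-! ### Hilbert series of quotients by regular sequences. -/

section HilbertSeries

attribute [local instance] MvPolynomial.gradedAlgebra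

variable {σ k : Type*} [Field k]

/-- The homogeneous elements of degree `d` of an ideal of a polynomial ring. -/
noncomputable def idealPiece (J : Ideal (MvPolynomial σ k)) (d : ℕ) :
    Submodule k (MvPolynomial σ k) :=
  J.restrictScalars k ⊓ homogeneousSubmodule σ k d

instance finiteDimensional_homogeneousSubmodule [Finite σ] (d : ℕ) :
    FiniteDimensional k (homogeneousSubmodule σ k d) :=
  Module.Finite.iff_fg.2 (homogeneousSubmodule_fg σ k d)

instance finiteDimensional_idealPiece [Finite σ] (J : Ideal (MvPolynomial σ k)) (d : ℕ) :
    FiniteDimensional k (idealPiece J d) :=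
  Submodule.finiteDimensional_inf_right _ _

theorem idealPiece_sup_of_lt {J : Ideal (MvPolynomial σ k)}
    (hJ : J.IsHomogeneous (homogeneousSubmodule σ k)) {f : MvPolynomial σ k} {d e : ℕ}
    (hf : f ∈ homogeneousSubmodule σ k e) (hd : d < e) :
    idealPiece (J ⊔ Ideal.span {f}) d = idealPiece J d := by
  refine le_antisymm ?_ (inf_le_inf_right _ fun p hp => Ideal.mem_sup_left hp)
  rintro p ⟨hp, hpd⟩
  refine ⟨?_, hpd⟩
  obtain ⟨a, ha, y, hy, rfl⟩ := Submodule.mem_sup.1 hp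
  obtain ⟨b, rfl⟩ := Ideal.mem_span_singleton'.1 hy
  have := DirectSum.decompose_of_mem_same (homogeneousSubmodule σ k) hpd
  rw [DirectSum.decompose_add, DirectSum.add_apply, AddMemClass.coe_add,
    DirectSum.coe_decompose_mul_of_right_mem_of_not_le _ hf hd.not_ge, add_zero] at this
  rw [← this]
  exact hJ d ha

theorem idealPiece_sup_add {J : Ideal (MvPolynomial σ k)}
    (hJ : J.IsHomogeneous (homogeneousSubmodule σ k)) {f : MvPolynomial σ k} {e : ℕ}
    (hf : f ∈ homogeneousSubmodule σ k e) (d : ℕ) :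
    idealPiece (J ⊔ Ideal.span {f}) (d + e) = idealPiece J (d + e) ⊔
      (homogeneousSubmodule σ k d).map (LinearMap.mulRight k f) := by
  apply le_antisymm
  · rintro p ⟨hp, hpd⟩
    obtain ⟨a, ha, y, hy, rfl⟩ := Submodule.mem_sup.1 hp
    obtain ⟨b, rfl⟩ := Ideal.mem_span_singleton'.1 hy
    have := DirectSum.decompose_of_mem_same (homogeneousSubmodule σ k) hpd
    rw [DirectSum.decompose_add, DirectSum.add_apply, AddMemClass.coe_add,
      DirectSum.coe_decompose_mul_of_right_mem_of_le _ hf (Nat.le_add_left e d),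
      Nat.add_sub_cancel] at this
    rw [← this]
    exact Submodule.add_mem_sup ⟨hJ _ ha, SetLike.coe_mem _⟩ ⟨_, SetLike.coe_mem _, rfl⟩
  · refine sup_le (inf_le_inf_right _ fun p hp => Ideal.mem_sup_left hp) ?_
    rintro _ ⟨b, hb, rfl⟩
    exact ⟨Ideal.mem_sup_right (Ideal.mem_span_singleton'.2 ⟨b, rfl⟩), IsHomogeneous.mul hb hf⟩

theorem idealPiece_inf_map {J : Ideal (MvPolynomial σ k)} {f : MvPolynomial σ k} {e : ℕ}
    (hf : f ∈ homogeneousSubmodule σ k e) (hreg : ∀ u, f * u ∈ J → u ∈ J) (d : ℕ) :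
    idealPiece J (d + e) ⊓ (homogeneousSubmodule σ k d).map (LinearMap.mulRight k f) =
      (idealPiece J d).map (LinearMap.mulRight k f) := by
  apply le_antisymm
  · rintro _ ⟨hp, b, hb, rfl⟩
    refine ⟨b, ⟨hreg b ?_, hb⟩, rfl⟩
    rw [mul_comm]
    exact hp.1
  · rintro _ ⟨b, hb, rfl⟩
    exact ⟨⟨J.mul_mem_right _ hb.1, IsHomogeneous.mul hb.2 hf⟩, b, hb.2, rfl⟩

/-- The degree `d + e` part of `J + (f)` is the sum of `J_{d+e}` and `f · S_d`, which by regularity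
meet in `f · J_d`; multiplication by `f` preserves dimension. -/
theorem finrank_idealPiece_sup_add [Finite σ] {J : Ideal (MvPolynomial σ k)}
    (hJ : J.IsHomogeneous (homogeneousSubmodule σ k)) {f : MvPolynomial σ k} {e : ℕ}
    (hf : f ∈ homogeneousSubmodule σ k e) (hf0 : f ≠ 0) (hreg : ∀ u, f * u ∈ J → u ∈ J) (d : ℕ) :
    Module.finrank k (idealPiece (J ⊔ Ideal.span {f}) (d + e)) +
        Module.finrank k (idealPiece J d) =
      Module.finrank k (idealPiece J (d + e)) +
        Module.finrank k (homogeneousSubmodule σ k d) := by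
  have hinj : Function.Injective (LinearMap.mulRight k f) := mul_left_injective₀ hf0
  rw [(Submodule.equivMapOfInjective _ hinj (idealPiece J d)).finrank_eq,
    (Submodule.equivMapOfInjective _ hinj (homogeneousSubmodule σ k d)).finrank_eq,
    idealPiece_sup_add hJ hf, ← idealPiece_inf_map hf hreg]
  exact Submodule.finrank_sup_add_finrank_inf_eq _ _

/-- The Hilbert series of the quotient of a polynomial ring by an ideal. -/
noncomputable def hilbertSeries (J : Ideal (MvPolynomial σ k)) : PowerSeries ℤ :=
  PowerSeries.mk fun d => (Module.finrank k (homogeneousSubmodule σ k d) : ℤ) -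
    Module.finrank k (idealPiece J d)

theorem hilbertSeries_sup [Finite σ] {J : Ideal (MvPolynomial σ k)}
    (hJ : J.IsHomogeneous (homogeneousSubmodule σ k)) {f : MvPolynomial σ k} {e : ℕ}
    (hf : f ∈ homogeneousSubmodule σ k e) (hf0 : f ≠ 0) (hreg : ∀ u, f * u ∈ J → u ∈ J) :
    hilbertSeries (J ⊔ Ideal.span {f}) = (1 - PowerSeries.X ^ e) * hilbertSeries J := by
  ext d
  rw [sub_mul, one_mul, map_sub, PowerSeries.coeff_X_pow_mul']
  simp only [hilbertSeries, PowerSeries.coeff_mk]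
  split_ifs with hed
  · obtain ⟨d, rfl⟩ := Nat.exists_eq_add_of_le' hed
    have := finrank_idealPiece_sup_add hJ hf hf0 hreg d
    rw [Nat.add_sub_cancel]
    zify at this
    linarith
  · rw [idealPiece_sup_of_lt hJ hf (not_le.1 hed), sub_zero]

theorem hilbertSeries_initialIdeal [Finite σ] {f : ℕ → MvPolynomial σ k} {e : ℕ → ℕ} {n : ℕ}
    (hf : ∀ i < n, (f i).IsHomogeneous (e i)) (hf0 : ∀ i < n, f i ≠ 0)
    (hreg : IsWeaklyRegularUpTo f n) :
    hilbertSeries (initialIdeal f n) =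
      (∏ i ∈ Finset.range n, (1 - PowerSeries.X ^ e i)) *
        hilbertSeries (⊥ : Ideal (MvPolynomial σ k)) := by
  induction n with
  | zero => simp [initialIdeal_zero]
  | succ n ih =>
    rw [initialIdeal_succ, hilbertSeries_sup
      (isHomogeneous_initialIdeal (e := e) fun j hj => hf j (by omega)) (hf n n.lt_succ_self)
      (hf0 n n.lt_succ_self) (hreg n n.lt_succ_self),
      ih (fun i hi => hf i (by omega)) (fun i hi => hf0 i (by omega))
        (fun i hi => hreg i (by omega)), Finset.prod_range_succ]
    ring

theorem hilbertSeries_idealOfVars : hilbertSeries (idealOfVars σ k) = 1 := by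
  ext d
  rw [hilbertSeries, PowerSeries.coeff_mk, PowerSeries.coeff_one]
  split_ifs with hd
  · subst hd
    have h0 : idealPiece (idealOfVars σ k) 0 = ⊥ := by
      rw [eq_bot_iff]
      rintro p ⟨hp, hp0⟩
      rw [homogeneousSubmodule_zero] at hp0
      obtain ⟨a, rfl⟩ := Submodule.mem_one.1 hp0
      have : constantCoeff (algebraMap k (MvPolynomial σ k) a) = 0 :=
        mem_idealOfVars_iff_constantCoeff.1 hp
      rw [algebraMap_eq, constantCoeff_C] at this
      simp [this]
    rw [h0, finrank_bot, homogeneousSubmodule_zero, Submodule.one_eq_span,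
      finrank_span_singleton one_ne_zero]
    simp
  · have : idealPiece (idealOfVars σ k) d = homogeneousSubmodule σ k d :=
      inf_eq_right.2 fun p hp => IsHomogeneous.mem_idealOfVars hp (Nat.pos_of_ne_zero hd)
    rw [this, sub_self]

/-- No monomials are counted: the variables are themselves a regular sequence by the criterion
above, and the quotient by them has Hilbert series `1`. -/
theorem one_sub_pow_mul_hilbertSeries_bot [Infinite k] (n : ℕ) :
    (1 - PowerSeries.X) ^ n * hilbertSeries (⊥ : Ideal (MvPolynomial (Fin n) k)) = 1 := by
  set x : ℕ → MvPolynomial (Fin n) k := fun i => if h : i < n then X ⟨i, h⟩ else 0 with hx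
  have hxi : ∀ i (h : i < n), x i = X ⟨i, h⟩ := fun i h => dif_pos h
  have hx1 : ∀ i < n, (x i).IsHomogeneous 1 := fun i hi => by
    rw [hxi i hi]; exact isHomogeneous_X _ _
  have hspan : initialIdeal x n = idealOfVars (Fin n) k := by
    rw [initialIdeal, idealOfVars]
    congr 1
    ext p
    constructor
    · rintro ⟨i, hi, rfl⟩
      exact ⟨⟨i, hi⟩, (hxi i hi).symm⟩
    · rintro ⟨i, rfl⟩
      exact ⟨i, i.2, hxi i i.2⟩
  have hreg := isWeaklyRegularUpTo_of_radical n x (fun _ => 1) (fun _ _ => one_pos) hx1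
    (fun i => Ideal.le_radical (by rw [hspan]; exact Ideal.subset_span ⟨i, rfl⟩))
  have := hilbertSeries_initialIdeal hx1 (fun i hi => by rw [hxi i hi]; exact X_ne_zero _) hreg
  rw [hspan, hilbertSeries_idealOfVars] at this
  simpa using this.symm

end HilbertSeries

/-! ### Coefficients of the resulting power series. -/

section Count

theorem hilbertSeries_eq_of_prod {n : ℕ} {H B : PowerSeries ℤ} {e : Fin n → ℕ}
    (hB : (1 - PowerSeries.X) ^ (n + 1) * B = 1)
    (hH : H = (∏ i, (1 - PowerSeries.X ^ e i)) * B) :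
    H = PowerSeries.mk 1 * ∏ i, ∑ j ∈ Finset.range (e i), PowerSeries.X ^ j := by
  have hprod : ∏ i, (1 - (PowerSeries.X : PowerSeries ℤ) ^ e i) =
      (1 - PowerSeries.X) ^ n * ∏ i, ∑ j ∈ Finset.range (e i), PowerSeries.X ^ j := by
    rw [Finset.prod_congr rfl fun i _ => (mul_neg_geom_sum PowerSeries.X (e i)).symm,
      Finset.prod_mul_distrib]
    simp
  -- `PowerSeries.mk 1` is `1 / (1 - X)`, the one factor left after `n` of the `n + 1` cancel.
  have h1 : (PowerSeries.mk 1 : PowerSeries ℤ) * (1 - PowerSeries.X) = 1 :=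
    PowerSeries.mk_one_mul_one_sub_eq_one ℤ
  rw [hH, hprod]
  set Q := ∏ i, ∑ j ∈ Finset.range (e i), (PowerSeries.X : PowerSeries ℤ) ^ j
  calc (1 - PowerSeries.X) ^ n * Q * B
      = (PowerSeries.mk 1 * (1 - PowerSeries.X)) * ((1 - PowerSeries.X) ^ n * Q * B) := by
        rw [h1, one_mul]
    _ = PowerSeries.mk 1 * Q * ((1 - PowerSeries.X) ^ (n + 1) * B) := by ring
    _ = _ := by rw [hB, mul_one]

theorem coeff_prod_geom_sum {n : ℕ} (g : Fin n → MvPolynomial (Fin n) ℝ) (k : ℕ) :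
    PowerSeries.coeff k (∏ i, ∑ j ∈ Finset.range (g i).totalDegree,
      (PowerSeries.X : PowerSeries ℤ) ^ j) = boundedTupleCount g k := by
  rw [Finset.prod_univ_sum, map_sum, boundedTupleCount, Finset.card_filter, Nat.cast_sum]
  refine Finset.sum_congr rfl fun κ _ => ?_
  rw [Finset.prod_pow_eq_pow_sum, PowerSeries.coeff_X_pow]
  simp [eq_comm]

theorem coeff_mk_one_mul_prod {n : ℕ} (g : Fin n → MvPolynomial (Fin n) ℝ) (d : ℕ) :
    PowerSeries.coeff d (PowerSeries.mk 1 * ∏ i, ∑ j ∈ Finset.range (g i).totalDegree,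
      (PowerSeries.X : PowerSeries ℤ) ^ j) =
        ((∑ k ∈ Finset.range (d + 1), boundedTupleCount g k : ℕ) : ℤ) := by
  rw [mul_comm, PowerSeries.coeff_mul, Finset.Nat.sum_antidiagonal_eq_sum_range_succ_mk,
    Nat.cast_sum]
  refine Finset.sum_congr rfl fun k _ => ?_
  rw [coeff_prod_geom_sum]
  simp

end Count

/-! ### Application to the homogenized system. -/

section Homogenization

variable {n : ℕ}

theorem isHomogeneous_homogenization (p : MvPolynomial (Fin n) ℝ) :
    (homogenization p).IsHomogeneous p.totalDegree := by
  refine IsHomogeneous.sum _ _ _ fun e he => ?_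
  have h := (isHomogeneous_X_pow (R := ℝ) (0 : Fin (n + 1)) (p.totalDegree - e)).mul
    ((homogeneousComponent_isHomogeneous e p).rename_isHomogeneous (f := Fin.succ))
  rwa [Nat.sub_add_cancel (Nat.lt_succ_iff.1 (Finset.mem_range.1 he))] at h

theorem homogenization_zero : homogenization (0 : MvPolynomial (Fin n) ℝ) = 0 := by
  simp [homogenization]

theorem homogenization_of_totalDegree_eq_zero {p : MvPolynomial (Fin n) ℝ}
    (h : p.totalDegree = 0) : homogenization p = C (coeff 0 p) := by
  simp [homogenization, h]

theorem aeval_homogenization_of_zero (p : MvPolynomial (Fin n) ℝ) {z : Fin (n + 1) → ℂ}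
    (hz : z 0 = 0) : aeval z (homogenization p) = aeval (Fin.tail z) (atInfinity p) := by
  rw [atInfinity, ← AlgHom.comp_apply]
  congr 1
  ext i
  refine Fin.cases ?_ (fun i => ?_) i
  · simp [hz]
  · simp [Fin.tail]

/-- The sequence of the homogenizations of the `g i` followed by the variable `X 0`. -/
noncomputable def homogenizedSeq (g : Fin n → MvPolynomial (Fin n) ℝ) (i : ℕ) :
    MvPolynomial (Fin (n + 1)) ℝ :=
  if h : i < n then homogenization (g ⟨i, h⟩) else X 0

theorem homogenizedSeq_of_lt (g : Fin n → MvPolynomial (Fin n) ℝ) {i : ℕ} (h : i < n) :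
    homogenizedSeq g i = homogenization (g ⟨i, h⟩) := dif_pos h

theorem homogenizedSeq_self (g : Fin n → MvPolynomial (Fin n) ℝ) :
    homogenizedSeq g n = X 0 := dif_neg (lt_irrefl n)

theorem initialIdeal_homogenizedSeq (g : Fin n → MvPolynomial (Fin n) ℝ) :
    initialIdeal (homogenizedSeq g) n = homogenizedIdeal g := by
  rw [initialIdeal, homogenizedIdeal]
  congr 1
  ext p
  constructor
  · rintro ⟨i, hi, rfl⟩
    exact ⟨⟨i, hi⟩, (homogenizedSeq_of_lt g hi).symm⟩
  · rintro ⟨i, rfl⟩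
    exact ⟨i, i.2, homogenizedSeq_of_lt g i.2⟩

theorem X_mem_radical_initialIdeal {g : Fin n → MvPolynomial (Fin n) ℝ}
    (hg : NoSolutionAtInfinity g) (i : Fin (n + 1)) :
    X i ∈ (initialIdeal (homogenizedSeq g) (n + 1)).radical := by
  rw [← vanishingIdeal_zeroLocus_eq_radical (K := ℂ), mem_vanishingIdeal_iff]
  intro z hz
  rw [mem_zeroLocus_iff] at hz
  have hmem : ∀ j < n + 1, homogenizedSeq g j ∈ initialIdeal (homogenizedSeq g) (n + 1) :=
    fun j hj => Ideal.subset_span ⟨j, hj, rfl⟩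
  have h0 : z 0 = 0 := by
    have := hz _ (hmem n n.lt_succ_self)
    rwa [homogenizedSeq_self, aeval_X] at this
  have htail : Fin.tail z = 0 := by
    by_contra hne
    refine hg ⟨Fin.tail z, hne, fun j => ?_⟩
    have := hz _ (hmem j (by omega))
    rwa [homogenizedSeq_of_lt g j.2, aeval_homogenization_of_zero _ h0] at this
  rw [aeval_X]
  refine Fin.cases h0 (fun j => ?_) i
  exact congrFun htail j

/-- Zero polynomials are admitted so that only nonzero constants remain exceptional. Since `0` is
homogeneous of every degree, `max 1` supplies the positive degree that the criterion requires. -/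
theorem isWeaklyRegularUpTo_homogenizedSeq {g : Fin n → MvPolynomial (Fin n) ℝ}
    (hg : NoSolutionAtInfinity g) (h : ∀ i, g i = 0 ∨ 0 < (g i).totalDegree) :
    IsWeaklyRegularUpTo (homogenizedSeq g) n := by
  have := isWeaklyRegularUpTo_of_radical (n + 1) (homogenizedSeq g)
    (fun i => if hi : i < n then max 1 (g ⟨i, hi⟩).totalDegree else 1) (fun i _ => by
      split_ifs <;> simp) (fun i hi => by
      split_ifs with hin
      · rw [homogenizedSeq_of_lt g hin]
        rcases h ⟨i, hin⟩ with h | h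
        · rw [h, homogenization_zero]; exact isHomogeneous_zero _ _ _
        · rw [max_eq_right h]; exact isHomogeneous_homogenization _
      · obtain rfl : i = n := by omega
        rw [homogenizedSeq_self]; exact isHomogeneous_X _ _)
    (X_mem_radical_initialIdeal hg)
  exact fun i hi => this i (by omega)

theorem initialIdeal_homogenizedSeq_le {g : Fin n → MvPolynomial (Fin n) ℝ}
    (h : ∀ i, g i = 0 ∨ 0 < (g i).totalDegree) :
    initialIdeal (homogenizedSeq g) n ≤ idealOfVars (Fin (n + 1)) ℝ := by
  rw [initialIdeal, Ideal.span_le]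
  rintro _ ⟨i, hi, rfl⟩
  rw [homogenizedSeq_of_lt g hi]
  rcases h ⟨i, hi⟩ with h | h
  · rw [h, homogenization_zero]; exact Ideal.zero_mem _
  · exact (isHomogeneous_homogenization _).mem_idealOfVars h

/-- If `0` were regular modulo the preceding forms, their ideal would contain `1`, although it lies
in the ideal of the variables. -/
theorem homogenizedSeq_ne_zero {g : Fin n → MvPolynomial (Fin n) ℝ}
    (hg : NoSolutionAtInfinity g) (h : ∀ i, g i = 0 ∨ 0 < (g i).totalDegree) {i : ℕ}
    (hi : i < n) : homogenizedSeq g i ≠ 0 := by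
  intro h0
  have h1 : (1 : MvPolynomial (Fin (n + 1)) ℝ) ∈ initialIdeal (homogenizedSeq g) i :=
    isWeaklyRegularUpTo_homogenizedSeq hg h i hi 1 (by rw [h0, zero_mul]; exact Ideal.zero_mem _)
  have := initialIdeal_homogenizedSeq_le h (initialIdeal_mono _ hi.le h1)
  exact (isPrime_idealOfVars.ne_top) ((Ideal.eq_top_iff_one _).2 this)

theorem ofList_take_ofFn (g : Fin n → MvPolynomial (Fin n) ℝ) {i : ℕ} (hi : i ≤ n) :
    Ideal.ofList ((List.ofFn fun i => homogenization (g i)).take i) =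
      initialIdeal (homogenizedSeq g) i := by
  rw [Ideal.ofList, initialIdeal]
  congr 1
  ext p
  simp only [Set.mem_ofPred_eq, List.mem_take_iff_getElem, Set.mem_image, Set.mem_Iio]
  constructor
  · rintro ⟨j, hj, rfl⟩
    simp only [List.length_ofFn, lt_min_iff] at hj
    exact ⟨j, hj.1, by rw [homogenizedSeq_of_lt g hj.2, List.getElem_ofFn]⟩
  · rintro ⟨j, hj, rfl⟩
    exact ⟨j, by simp; omega, by rw [homogenizedSeq_of_lt g (hj.trans_le hi), List.getElem_ofFn]⟩

theorem isRegular_homogenization {g : Fin n → MvPolynomial (Fin n) ℝ}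
    (hg : NoSolutionAtInfinity g) (h : ∀ i, 0 < (g i).totalDegree) :
    RingTheory.Sequence.IsRegular (MvPolynomial (Fin (n + 1)) ℝ)
      (List.ofFn fun i => homogenization (g i)) := by
  rw [RingTheory.Sequence.isRegular_iff, RingTheory.Sequence.isWeaklyRegular_iff]
  constructor
  · intro i hi
    have hin : i < n := by simpa using hi
    rw [ofList_take_ofFn g hin.le, isSMulRegular_iff_right_eq_zero_of_smul]
    intro x hx
    obtain ⟨u, rfl⟩ := Submodule.Quotient.mk_surjective _ x
    rw [← Submodule.Quotient.mk_smul, Submodule.Quotient.mk_eq_zero, smul_eq_mul, Ideal.mul_top,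
      List.getElem_ofFn, smul_eq_mul] at hx
    rw [Submodule.Quotient.mk_eq_zero, smul_eq_mul, Ideal.mul_top]
    refine isWeaklyRegularUpTo_homogenizedSeq hg (fun i => Or.inr (h i)) i hin u ?_
    rwa [homogenizedSeq_of_lt g hin]
  · have := ofList_take_ofFn g le_rfl
    rw [List.take_of_length_le (by simp)] at this
    rw [this, smul_eq_mul, Ideal.mul_top]
    intro htop
    have hle := initialIdeal_homogenizedSeq_le (g := g) fun i => Or.inr (h i)
    rw [← htop, top_le_iff] at hle
    exact isPrime_idealOfVars.ne_top hle

theorem finrank_gradedPart (I : Ideal (MvPolynomial (Fin (n + 1)) ℝ)) (d : ℕ) :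
    Module.finrank ℝ (gradedPart I d) = Module.finrank ℝ (idealPiece I d) := by
  rw [idealPiece, inf_comm, ← Submodule.map_comap_subtype]
  exact (Submodule.equivMapOfInjective _ (Submodule.injective_subtype _) _).finrank_eq

theorem finrank_quotient_gradedPart (I : Ideal (MvPolynomial (Fin (n + 1)) ℝ)) (d : ℕ) :
    (Module.finrank ℝ (homogeneousSubmodule (Fin (n + 1)) ℝ d ⧸ gradedPart I d) : ℤ) =
      PowerSeries.coeff d (hilbertSeries I) := by
  rw [hilbertSeries, PowerSeries.coeff_mk, ← finrank_gradedPart,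
    ← Submodule.finrank_quotient_add_finrank (gradedPart I d)]
  push_cast
  ring

theorem finrank_quotient_homogenizedIdeal {g : Fin n → MvPolynomial (Fin n) ℝ}
    (hg : NoSolutionAtInfinity g) (d : ℕ) :
    Module.finrank ℝ (homogeneousSubmodule (Fin (n + 1)) ℝ d ⧸ gradedPart (homogenizedIdeal g) d) =
      ∑ k ∈ Finset.range (d + 1), boundedTupleCount g k := by
  by_cases h : ∀ i, g i = 0 ∨ 0 < (g i).totalDegree
  · have hH := hilbertSeries_initialIdeal
      (e := fun i => if hi : i < n then (g ⟨i, hi⟩).totalDegree else 0)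
      (fun i hi => by
        rw [homogenizedSeq_of_lt g hi]
        simpa [hi] using isHomogeneous_homogenization (g ⟨i, hi⟩))
      (fun i hi => homogenizedSeq_ne_zero hg h hi) (isWeaklyRegularUpTo_homogenizedSeq hg h)
    rw [Finset.prod_range, initialIdeal_homogenizedSeq] at hH
    simp only [Fin.is_lt, dite_true, Fin.eta] at hH
    have := hilbertSeries_eq_of_prod (one_sub_pow_mul_hilbertSeries_bot (n + 1)) hH
    exact_mod_cast (finrank_quotient_gradedPart (homogenizedIdeal g) d).trans
      ((congrArg _ this).trans (coeff_mk_one_mul_prod g d))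
  -- Some `g i` is a nonzero constant: `𝐈` is the whole ring, and no `κ i < 0` exists, so all counts
  -- vanish.
  · push Not at h
    obtain ⟨i, hi0, hi⟩ := h
    have hdeg : (g i).totalDegree = 0 := Nat.le_zero.1 hi
    have htop : homogenizedIdeal g = ⊤ := by
      refine Ideal.eq_top_of_isUnit_mem _ (Ideal.subset_span ⟨i, rfl⟩) ?_
      dsimp only
      rw [homogenization_of_totalDegree_eq_zero hdeg]
      refine (isUnit_iff_ne_zero.2 fun h0 => hi0 ?_).map C
      rw [totalDegree_eq_zero_iff_eq_C.1 hdeg, h0, C_0]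
    have hzero : ∀ k, boundedTupleCount g k = 0 := fun k => by
      rw [boundedTupleCount, Finset.card_eq_zero, Finset.filter_eq_empty_iff]
      intro κ hκ
      have := Fintype.mem_piFinset.1 hκ i
      simp [hdeg] at this
    have hgr : gradedPart (homogenizedIdeal g) d = ⊤ := by
      rw [htop]
      exact Submodule.eq_top_iff'.2 fun _ => trivial
    have : Subsingleton (homogeneousSubmodule (Fin (n + 1)) ℝ d ⧸
        gradedPart (homogenizedIdeal g) d) := Submodule.Quotient.subsingleton_iff.2 hgr
    rw [Module.finrank_zero_of_subsingleton, Finset.sum_eq_zero fun k _ => hzero k]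

end Homogenization

theorem mainTheorem5 (n : ℕ) (g : Fin n → MvPolynomial (Fin n) ℝ)
    (hg : NoSolutionAtInfinity g) :
    ((∀ i, 0 < (g i).totalDegree) →
      RingTheory.Sequence.IsRegular (MvPolynomial (Fin (n + 1)) ℝ)
        (List.ofFn fun i => homogenization (g i))) ∧
    ∀ d : ℕ,
      Module.rank ℝ (homogeneousSubmodule (Fin (n + 1)) ℝ d ⧸ gradedPart (homogenizedIdeal g) d)
        = ((∑ k ∈ Finset.range (d + 1), boundedTupleCount g k : ℕ) : Cardinal) := by
  refine ⟨isRegular_homogenization hg, fun d => ?_⟩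
  rw [← Module.finrank_eq_rank, finrank_quotient_homogenizedIdeal hg]
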